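/- Let $d\ge 1$, $0<T<\infty$, and let $\Omega=\mathbb R^d_+=\{x\in\mathbb R^d : x_d>0\}$. Call $\phi$ an admissible test function if $$\phi\in C\big([0,T];\,W^{1,1}_0(\Omega)\cap W^{2,1}(\Omega)\cap C(\Omega)\big)\cap C^1\big([0,T];\,L^1(\Omega)\big)$$ and there is a constant $C$ (depending on $\phi$) such that $|\nabla\phi(t,x)|\le C(1+|x|^2)^{-d/2}$ for all $t\in[0,T]$ and almost every $x\in\Omega$. Here $W^{1,1}_0(\Omega)$ is the closure of $C_c^\infty(\Omega)$ in $W^{1,1}(\Omega)$, $C(\Omega)$ carries the topology of locally uniform convergence, and spatial derivatives are weak derivatives. Let $u:(0,T)\times\Omega\to\mathbb R$ be a function such that, for every admissible test function $\phi$, the function $u(\partial_t\phi+\Delta\phi)$ is integrable on $(0,T)\times\Omega$ and $$\int_0^T\int_\Omega u\,(\partial_t\phi+\Delta\phi)\,dx\,dt=0 .$$ Then $u=0$ almost everywhere in $(0,T)\times\Omega$. -/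

import Mathlib

open MeasureTheory Set Filter Topology
open scoped ContDiff

/-- The half space `ℝ^d_+ = {x ∈ ℝ^d | x_d > 0}` (`⊤ : Fin d` is the last index). -/
def halfSpace (d : ℕ) [NeZero d] : Set (EuclideanSpace ℝ (Fin d)) :=
  {x | 0 < x (⊤ : Fin d)}

/-- `η ∈ C_c^∞(Ω)`. -/
def IsSmoothCompactlySupportedIn {d : ℕ} (Ω : Set (EuclideanSpace ℝ (Fin d)))
    (η : EuclideanSpace ℝ (Fin d) → ℝ) : Prop :=
  ContDiff ℝ ∞ η ∧ HasCompactSupport η ∧ tsupport η ⊆ Ω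

/-- The classical partial derivative `∂_i η`. -/
noncomputable def partialDeriv {d : ℕ} (i : Fin d) (η : EuclideanSpace ℝ (Fin d) → ℝ)
    (x : EuclideanSpace ℝ (Fin d)) : ℝ :=
  fderiv ℝ η x (EuclideanSpace.single i 1)

/-- `g` is the weak partial derivative `∂_i f` in the open set `Ω`. -/
def HasWeakPartialDeriv {d : ℕ} (Ω : Set (EuclideanSpace ℝ (Fin d))) (i : Fin d)
    (f g : EuclideanSpace ℝ (Fin d) → ℝ) : Prop :=
  LocallyIntegrableOn f Ω ∧ LocallyIntegrableOn g Ω ∧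
    ∀ η : EuclideanSpace ℝ (Fin d) → ℝ, IsSmoothCompactlySupportedIn Ω η →
      ∫ x in Ω, f x * partialDeriv i η x = -∫ x in Ω, g x * η x

/-- `f ∈ W^{1,1}(Ω)`, with weak gradient `g`. -/
def MemW11 {d : ℕ} (Ω : Set (EuclideanSpace ℝ (Fin d))) (f : EuclideanSpace ℝ (Fin d) → ℝ)
    (g : Fin d → EuclideanSpace ℝ (Fin d) → ℝ) : Prop :=
  IntegrableOn f Ω ∧ ∀ i, IntegrableOn (g i) Ω ∧ HasWeakPartialDeriv Ω i f (g i)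

/-- `f ∈ W^{2,1}(Ω)`, with weak gradient `g` and weak second derivatives
`h i j = ∂_j ∂_i f`. -/
def MemW21 {d : ℕ} (Ω : Set (EuclideanSpace ℝ (Fin d))) (f : EuclideanSpace ℝ (Fin d) → ℝ)
    (g : Fin d → EuclideanSpace ℝ (Fin d) → ℝ)
    (h : Fin d → Fin d → EuclideanSpace ℝ (Fin d) → ℝ) : Prop :=
  MemW11 Ω f g ∧ ∀ i, MemW11 Ω (g i) (h i)

/-- `f ∈ W_0^{1,1}(Ω)`: `f` lies in the closure of `C_c^∞(Ω)` in `W^{1,1}(Ω)`. -/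
def MemW11Zero {d : ℕ} (Ω : Set (EuclideanSpace ℝ (Fin d)))
    (f : EuclideanSpace ℝ (Fin d) → ℝ) : Prop :=
  ∃ g : Fin d → EuclideanSpace ℝ (Fin d) → ℝ, MemW11 Ω f g ∧
    ∀ ε : ℝ, 0 < ε → ∃ η : EuclideanSpace ℝ (Fin d) → ℝ, IsSmoothCompactlySupportedIn Ω η ∧
      (∫ x in Ω, (|f x - η x| + ∑ i, |g i x - partialDeriv i η x|)) < ε

/-- `F ∈ C([0,T]; L^1(Ω))`. -/
def ContinuousInL1 {d : ℕ} (T : ℝ) (Ω : Set (EuclideanSpace ℝ (Fin d)))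
    (F : ℝ → EuclideanSpace ℝ (Fin d) → ℝ) : Prop :=
  ∀ t ∈ Icc 0 T, IntegrableOn (F t) Ω ∧
    Tendsto (fun s => ∫ x in Ω, |F s x - F t x|) (𝓝[Icc 0 T] t) (𝓝 0)

/-- `F ∈ C^1([0,T]; L^1(Ω))`, with derivative `F'` (one-sided at `t = 0` and `t = T`). -/
def HasContinuousDerivInL1 {d : ℕ} (T : ℝ) (Ω : Set (EuclideanSpace ℝ (Fin d)))
    (F F' : ℝ → EuclideanSpace ℝ (Fin d) → ℝ) : Prop :=
  ContinuousInL1 T Ω F ∧ ContinuousInL1 T Ω F' ∧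
    ∀ t ∈ Icc 0 T, Tendsto (fun s => ∫ x in Ω, |(s - t)⁻¹ * (F s x - F t x) - F' t x|)
      (𝓝[Icc 0 T \ {t}] t) (𝓝 0)

/-- `φ` belongs to
`C([0,T]; W_0^{1,1}(Ω) ∩ W^{2,1}(Ω) ∩ C(Ω)) ∩ C^1([0,T]; L^1(Ω))`
and satisfies `|∇φ(t,x)| ≤ C (1 + |x|^2)^{-d/2}`.
The functions `φt`, `g i`, `h i j` are jointly measurable representatives of
`∂_t φ`, `∂_i φ`, `∂_j ∂_i φ`; they are determined by `φ` up to null sets. -/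
structure IsHeatTestFunction {d : ℕ} (T : ℝ) (Ω : Set (EuclideanSpace ℝ (Fin d)))
    (φ φt : ℝ → EuclideanSpace ℝ (Fin d) → ℝ)
    (g : Fin d → ℝ → EuclideanSpace ℝ (Fin d) → ℝ)
    (h : Fin d → Fin d → ℝ → EuclideanSpace ℝ (Fin d) → ℝ) : Prop where
  /-- joint measurability of the chosen representatives -/
  measurable_timeDeriv : AEStronglyMeasurable (Function.uncurry φt)
    (volume.restrict (Ioo 0 T ×ˢ Ω))
  measurable_grad : ∀ i, AEStronglyMeasurable (Function.uncurry (g i))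
    (volume.restrict (Ioo 0 T ×ˢ Ω))
  measurable_hess : ∀ i j, AEStronglyMeasurable (Function.uncurry (h i j))
    (volume.restrict (Ioo 0 T ×ˢ Ω))
  /-- `φ(t) ∈ W_0^{1,1}(Ω) ∩ W^{2,1}(Ω) ∩ C(Ω)` -/
  memW11Zero : ∀ t ∈ Icc 0 T, MemW11Zero Ω (φ t)
  memW21 : ∀ t ∈ Icc 0 T, MemW21 Ω (φ t) (fun i => g i t) (fun i j => h i j t)
  continuousOn : ∀ t ∈ Icc 0 T, ContinuousOn (φ t) Ω
  /-- continuity of `t ↦ φ(t)` in the `W^{2,1}(Ω)` norm -/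
  continuousInL1 : ContinuousInL1 T Ω φ
  continuousInL1_grad : ∀ i, ContinuousInL1 T Ω (g i)
  continuousInL1_hess : ∀ i j, ContinuousInL1 T Ω (h i j)
  /-- continuity of `t ↦ φ(t)` in `C(Ω)`, with locally uniform convergence -/
  continuousInC : ∀ t ∈ Icc 0 T, TendstoLocallyUniformlyOn φ (φ t) (𝓝[Icc 0 T] t) Ω
  /-- `φ ∈ C^1([0,T]; L^1(Ω))` with derivative `φt` -/
  hasDerivInL1 : HasContinuousDerivInL1 T Ω φ φt
  /-- the decay of the gradient -/
  grad_bound : ∃ C : ℝ, ∀ t ∈ Icc 0 T, ∀ᵐ x ∂(volume.restrict Ω),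
    Real.sqrt (∑ i, g i t x ^ 2) ≤ C * (1 + ‖x‖ ^ 2) ^ (-(d : ℝ) / 2)

/-! Separation of variables suffices: for `φ = exp (-l t) b(x)`, the backward heat operator gives
`exp (-l t) (Δ b - l b)`, and test functions need no condition at `t = 0` or `t = T`. Given `ζ ∈
C_c^∞(Ω)`, a Fourier multiplier solves `Δ b - l b = ζ` on the whole space for `l > 0`. Subtracting
the reflection of `b` in `x_d = 0` makes it vanish on the boundary without changing the equation in
`Ω`. Such a Schwartz `b` lies in `W_0^{1,1}(Ω)` (`SchwartzMap.memW11Zero_halfSpace`), so `φ` is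
admissible (`isHeatTestFunction_exp_mul`).

Hence `u` is orthogonal to `exp (-a (n + 1) t) ζ(x)` with `a = (2π)²`, for all `n` and `ζ`.
Polynomials in `exp (-a t)` are uniformly dense in the continuous functions on `[0, T]`, so Fubini
and Weierstrass give `u = 0` almost everywhere, once a spatial cutoff has made everything
integrable. -/

/-! ### Resolvent of the Laplacian on Schwartz space -/

section Resolvent

open scoped SchwartzMap LineDeriv Laplacian

variable {E : Type*} [NormedAddCommGroup E] [InnerProductSpace ℝ E]

/-- Rescaling by `√c` reduces to the case `c = 1`. -/
theorem hasTemperateGrowth_add_norm_sq_inv {c : ℝ} (hc : 0 < c) :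
    (fun x : E ↦ (c + ‖x‖ ^ 2)⁻¹).HasTemperateGrowth := by
  have h1 : (fun x : E ↦ (1 + ‖x‖ ^ 2) ^ (-1 : ℝ)).HasTemperateGrowth := by fun_prop
  have h2 := (h1.comp (((Real.sqrt c)⁻¹ • ContinuousLinearMap.id ℝ E).hasTemperateGrowth))
  have h3 := (Function.HasTemperateGrowth.const (E := E) c⁻¹).mul h2
  refine (congrArg Function.HasTemperateGrowth (funext fun x ↦ ?_)).mp h3
  have hs : Real.sqrt c ^ 2 = c := Real.sq_sqrt hc.le
  simp only [Function.comp, Pi.mul_apply, _root_.smul_apply,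
    ContinuousLinearMap.id_apply, norm_smul, mul_pow, norm_inv, inv_pow, Real.norm_eq_abs, sq_abs,
    hs, Real.rpow_neg_one]
  rw [← mul_inv]
  congr 1
  field_simp

variable [FiniteDimensional ℝ E]

/-- The Laplacian may be computed in any orthonormal basis; the two sides use a basis and its image
under `A`. -/
theorem SchwartzMap.laplacian_comp_linearIsometryEquiv (A : E ≃ₗᵢ[ℝ] E) (f : 𝓢(E, ℝ)) :
    Δ (compCLMOfContinuousLinearEquiv ℝ A.toContinuousLinearEquiv f)
      = compCLMOfContinuousLinearEquiv ℝ A.toContinuousLinearEquiv (Δ f) := by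
  rw [laplacian_eq_sum (stdOrthonormalBasis ℝ E),
    laplacian_eq_sum ((stdOrthonormalBasis ℝ E).map A), map_sum]
  simp_rw [lineDerivOp_compCLMOfContinuousLinearEquiv]
  rfl

variable [MeasurableSpace E] [BorelSpace E]

/-- The resolvent equation `Δ b - (2π)² c b = f` is solvable in the Schwartz space. -/
theorem SchwartzMap.exists_laplacian_sub_smul_eq_complex {c : ℝ} (hc : 0 < c) (f : 𝓢(E, ℂ)) :
    ∃ b : 𝓢(E, ℂ), Δ b - ((2 * Real.pi) ^ 2 * c) • b = f := by
  have hg := hasTemperateGrowth_add_norm_sq_inv (E := E) hc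
  have hq : (fun x : E ↦ ‖x‖ ^ 2).HasTemperateGrowth := by fun_prop
  -- The symbol of `Δ` is `-(2π)² ‖ξ‖²`, so that of `Δ - (2π)² c` is `-(2π)² (c + ‖ξ‖²)`; the
  -- witness applies its inverse.
  refine ⟨-((2 * Real.pi) ^ 2)⁻¹ • fourierMultiplierCLM ℂ (fun x : E ↦ (c + ‖x‖ ^ 2)⁻¹) f, ?_⟩
  have hsum : fourierMultiplierCLM ℂ (fun x : E ↦ c + ‖x‖ ^ 2)
      = fourierMultiplierCLM ℂ (fun _ : E ↦ c) + fourierMultiplierCLM ℂ (‖·‖ ^ 2) := by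
    ext1 g
    have := smulLeftCLM_add (F := ℂ) (Function.HasTemperateGrowth.const (E := E) c) hq
    simp only [fourierMultiplierCLM_apply, _root_.add_apply]
    rw [← FourierTransform.fourierInv_add, ← _root_.add_apply, ← this]
    rfl
  have hinv : fourierMultiplierCLM ℂ (fun x : E ↦ c + ‖x‖ ^ 2)
      (fourierMultiplierCLM ℂ (fun x : E ↦ (c + ‖x‖ ^ 2)⁻¹) f) = f := by
    rw [fourierMultiplierCLM_fourierMultiplierCLM_apply (by fun_prop) hg]
    have : ((fun x : E ↦ c + ‖x‖ ^ 2) * fun x : E ↦ (c + ‖x‖ ^ 2)⁻¹) = fun _ ↦ (1 : ℝ) := by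
      ext x
      exact mul_inv_cancel₀ (by positivity)
    rw [this]
    simp
  set B := fourierMultiplierCLM ℂ (fun x : E ↦ (c + ‖x‖ ^ 2)⁻¹) f
  rw [hsum, _root_.add_apply, fourierMultiplierCLM_const] at hinv
  rw [laplacian_eq_fourierMultiplierCLM, map_smul, ← hinv]
  have hpi : ((2 * Real.pi) ^ 2 : ℝ) ≠ 0 := by positivity
  rw [smul_smul, smul_smul, sub_eq_add_neg, ← neg_smul, add_comm]
  congr 1
  · simp only [_root_.smul_apply, ContinuousLinearMap.id_apply]
    congr 1
    field_simp
  · rw [neg_mul_neg, mul_inv_cancel₀ hpi, one_smul]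

/-- The operator has real coefficients, so the real part of a complex solution solves the real
equation. -/
theorem SchwartzMap.exists_laplacian_sub_smul_eq {c : ℝ} (hc : 0 < c) (f : 𝓢(E, ℝ)) :
    ∃ b : 𝓢(E, ℝ), Δ b - ((2 * Real.pi) ^ 2 * c) • b = f := by
  obtain ⟨b, hb⟩ := exists_laplacian_sub_smul_eq_complex hc
    (f.postcompCLM (𝕜 := ℝ) Complex.ofRealCLM)
  generalize (2 * Real.pi) ^ 2 * c = k at hb ⊢
  have hcomm : ∀ (m : E) (g : 𝓢(E, ℂ)), ∂_{m} (g.postcompCLM (𝕜 := ℝ) Complex.reCLM)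
      = (∂_{m} g).postcompCLM (𝕜 := ℝ) Complex.reCLM := by
    intro m g
    ext x
    rw [lineDerivOp_apply_eq_fderiv, postcompCLM_apply, lineDerivOp_apply_eq_fderiv]
    have := (Complex.reCLM.hasFDerivAt.comp x (g.hasFDerivAt x)).fderiv
    have h2 : (⇑(g.postcompCLM (𝕜 := ℝ) Complex.reCLM)) = Complex.reCLM ∘ g := by
      ext y; rfl
    rw [h2, this]
    rfl
  refine ⟨b.postcompCLM (𝕜 := ℝ) Complex.reCLM, ?_⟩
  rw [laplacian_eq_sum (stdOrthonormalBasis ℝ E)] at hb ⊢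
  simp_rw [hcomm]
  ext x
  have := congrArg Complex.re (DFunLike.congr_fun hb x)
  simpa [_root_.sum_apply] using this

end Resolvent

/-! ### Dirichlet condition by odd reflection -/

section Reflection

open scoped SchwartzMap LineDeriv Laplacian

variable {d : ℕ} [NeZero d]

/-- The reflection in the hyperplane `x_d = 0`. -/
noncomputable def lastReflection (d : ℕ) [NeZero d] :
    EuclideanSpace ℝ (Fin d) ≃ₗᵢ[ℝ] EuclideanSpace ℝ (Fin d) :=
  LinearIsometryEquiv.piLpCongrRight 2
    fun i ↦ if i = ⊤ then LinearIsometryEquiv.neg ℝ else LinearIsometryEquiv.refl ℝ ℝ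

theorem lastReflection_apply (x : EuclideanSpace ℝ (Fin d)) (i : Fin d) :
    lastReflection d x i = if i = ⊤ then -x i else x i := by
  by_cases hi : i = ⊤ <;> simp [lastReflection, hi]

/-- For `η` vanishing below the boundary, `Δ b - (2π)² c b = η` has a Schwartz solution on the half
space that vanishes on the boundary. -/
theorem exists_schwartz_dirichlet_resolvent {c : ℝ} (hc : 0 < c)
    (η : 𝓢(EuclideanSpace ℝ (Fin d), ℝ)) (hη : ∀ x, x (⊤ : Fin d) ≤ 0 → η x = 0) :
    ∃ b : 𝓢(EuclideanSpace ℝ (Fin d), ℝ), (∀ x, x (⊤ : Fin d) = 0 → b x = 0) ∧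
      ∀ x ∈ halfSpace d, ∑ i : Fin d, (∂_{EuclideanSpace.single i (1 : ℝ)}
        (∂_{EuclideanSpace.single i (1 : ℝ)} b) : 𝓢(EuclideanSpace ℝ (Fin d), ℝ)) x - ((2 * Real.pi) ^ 2 * c) * b x = η x := by
  obtain ⟨b, hb⟩ := SchwartzMap.exists_laplacian_sub_smul_eq hc η
  set R := SchwartzMap.compCLMOfContinuousLinearEquiv (F := ℝ) ℝ
    (lastReflection d).toContinuousLinearEquiv
  have hR : ∀ (g : 𝓢(EuclideanSpace ℝ (Fin d), ℝ)) x, R g x = g (lastReflection d x) :=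
    fun _ _ ↦ rfl
  -- The odd part of `b` vanishes on the hyperplane, and its right-hand side `η - R η` equals `η` in
  -- the half space because `R η` is zero there.
  refine ⟨b - R b, fun x hx ↦ ?_, fun x hx ↦ ?_⟩
  · have : lastReflection d x = x := by
      ext i
      rw [lastReflection_apply]
      split_ifs with hi
      · rw [hi, hx, neg_zero]
      · rfl
    rw [_root_.sub_apply, hR, this, sub_self]
  · have h1 : Δ (b - R b) - ((2 * Real.pi) ^ 2 * c) • (b - R b) = η - R η := by
      have : Δ (b - R b) = Δ b - R (Δ b) := by
        rw [← SchwartzMap.laplacian_comp_linearIsometryEquiv]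
        exact map_sub (LineDeriv.laplacianCLM ℝ (EuclideanSpace ℝ (Fin d)) 𝓢(EuclideanSpace ℝ (Fin d), ℝ)) _ _
      rw [this, ← hb, map_sub, map_smul, smul_sub]
      abel
    have h2 := DFunLike.congr_fun h1 x
    rw [SchwartzMap.laplacian_eq_sum (EuclideanSpace.basisFun (Fin d) ℝ)] at h2
    have h3 : η (lastReflection d x) = 0 := by
      apply hη
      rw [lastReflection_apply, if_pos rfl]
      exact neg_nonpos.2 (le_of_lt hx)
    simpa [_root_.sum_apply, hR, h3] using h2

end Reflection

/-! ### Boundary decay and cutoffs -/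

section Cutoff

open scoped SchwartzMap

theorem isOpen_halfSpace (d : ℕ) [NeZero d] : IsOpen (halfSpace d) :=
  isOpen_lt continuous_const (by fun_prop)

theorem SchwartzMap.exists_norm_le_one_add_norm_pow {E F : Type*} [NormedAddCommGroup E]
    [NormedSpace ℝ E] [NormedAddCommGroup F] [NormedSpace ℝ F] (b : 𝓢(E, F)) (N : ℕ) :
    ∃ C, 0 ≤ C ∧ ∀ x, ‖fderiv ℝ b x‖ ≤ C * ((1 + ‖x‖) ^ N)⁻¹ := by
  refine ⟨2 ^ N * (Finset.Iic (N, 1)).sup (fun m ↦ SchwartzMap.seminorm ℝ m.1 m.2) b,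
    by positivity, fun x ↦ ?_⟩
  have := SchwartzMap.one_add_le_sup_seminorm_apply (𝕜 := ℝ) (m := (N, 1)) le_rfl le_rfl b x
  rw [norm_iteratedFDeriv_one] at this
  rw [← div_eq_mul_inv, le_div_iff₀ (by positivity)]
  linarith

theorem exists_abs_deriv_smoothTransition_le :
    ∃ C, 0 ≤ C ∧ ∀ t, |deriv Real.smoothTransition t| ≤ C := by
  have hc : Continuous (deriv Real.smoothTransition) :=
    (Real.smoothTransition.contDiff (n := 1)).continuous_deriv le_rfl
  obtain ⟨C, hC⟩ := (isCompact_Icc (a := (0 : ℝ)) (b := 1)).exists_bound_of_continuousOn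
    hc.continuousOn
  have h0 : 0 ≤ C := (norm_nonneg _).trans (hC 0 (by simp))
  refine ⟨C, h0, fun t ↦ ?_⟩
  by_cases ht : t ∈ Icc (0 : ℝ) 1
  · exact hC t ht
  · have : deriv Real.smoothTransition t = 0 := by
      rw [mem_Icc, not_and_or, not_le, not_le] at ht
      rcases ht with ht | ht
      · have : Real.smoothTransition =ᶠ[𝓝 t] fun _ ↦ 0 := by
          filter_upwards [Iio_mem_nhds ht] with s hs
          exact Real.smoothTransition.zero_of_nonpos (le_of_lt hs)
        rw [this.deriv_eq, deriv_const]
      · have : Real.smoothTransition =ᶠ[𝓝 t] fun _ ↦ 1 := by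
          filter_upwards [Ioi_mem_nhds ht] with s hs
          exact Real.smoothTransition.one_of_one_le (le_of_lt hs)
        rw [this.deriv_eq, deriv_const]
    rw [this, abs_zero]
    exact h0

/-- A smooth function vanishing on the boundary is controlled near it by the distance. -/
theorem SchwartzMap.exists_integrable_abs_le_mul {d : ℕ} [NeZero d]
    (b : 𝓢(EuclideanSpace ℝ (Fin d), ℝ)) (hb : ∀ x, x (⊤ : Fin d) = 0 → b x = 0) :
    ∃ M : EuclideanSpace ℝ (Fin d) → ℝ, Integrable M ∧
      ∀ x ∈ halfSpace d, |b x| ≤ x (⊤ : Fin d) * M x := by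
  obtain ⟨C, hC0, hC⟩ := b.exists_norm_le_one_add_norm_pow (d + 1)
  -- The first term serves `x_d ≥ 1`, the second `x_d ≤ 1`. The exponent `d + 1` exceeds the
  -- dimension, which gives integrability; `2 ^ (d + 1)` comes from `1 + ‖x‖ ≤ 2 (1 + ‖z‖)` for `‖z
  -- - x‖ ≤ 1`.
  refine ⟨fun x ↦ |b x| + C * 2 ^ (d + 1) * (1 + ‖x‖) ^ (-((d + 1 : ℕ) : ℝ)), ?_, ?_⟩
  · refine b.integrable.abs.add ((integrable_one_add_norm ?_).const_mul _)
    simp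
  · intro x hx
    have hx0 : 0 < x ⊤ := hx
    have hpos : 0 ≤ C * 2 ^ (d + 1) * (1 + ‖x‖) ^ (-((d + 1 : ℕ) : ℝ)) := by positivity
    rcases le_total 1 (x ⊤) with h1 | h1
    · nlinarith [abs_nonneg (b x)]
    -- `y` is the foot of the perpendicular from `x` to the boundary, where `b` vanishes; the mean
    -- value inequality is applied between `y` and `x`.
    · set y := x - EuclideanSpace.single (⊤ : Fin d) (x ⊤)
      have hy : b y = 0 := hb y (by simp [y])
      have hyx : ‖x - y‖ = x ⊤ := by simp [y, abs_of_pos hx0]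
      have hbd : ∀ z ∈ Metric.closedBall x 1,
          ‖fderiv ℝ b z‖ ≤ C * 2 ^ (d + 1) * (1 + ‖x‖) ^ (-((d + 1 : ℕ) : ℝ)) := by
        intro z hz
        refine (hC z).trans ?_
        rw [mul_assoc, Real.rpow_neg (by positivity), Real.rpow_natCast]
        gcongr
        rw [← div_eq_mul_inv, inv_eq_one_div, div_le_div_iff₀ (by positivity) (by positivity),
          one_mul, ← mul_pow]
        gcongr
        have := norm_le_norm_add_norm_sub z x
        rw [mem_closedBall_iff_norm] at hz
        linarith [norm_nonneg z]
      have := (convex_closedBall x 1).norm_image_sub_le_of_norm_fderiv_le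
        (fun z _ ↦ b.differentiableAt) hbd (x := y) (y := x)
        (by rw [mem_closedBall_iff_norm, norm_sub_rev, hyx]; exact h1)
        (Metric.mem_closedBall_self zero_le_one)
      rw [hy, sub_zero, hyx, Real.norm_eq_abs] at this
      nlinarith [abs_nonneg (b x)]

/-- Cutoff functions exhausting the half space, with gradient controlled by the inverse distance
to the boundary. -/
theorem exists_halfSpace_cutoff (d : ℕ) [NeZero d] :
    ∃ (m : ℕ → EuclideanSpace ℝ (Fin d) → ℝ) (C : ℝ),
      (∀ n, IsSmoothCompactlySupportedIn (halfSpace d) (m n)) ∧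
      (∀ n x, |m n x| ≤ 1) ∧
      (∀ n, ∀ x ∈ halfSpace d, ∀ i, |partialDeriv i (m n) x| ≤ C + C / x (⊤ : Fin d)) ∧
      ∀ x ∈ halfSpace d, ∀ᶠ n in atTop, m n =ᶠ[𝓝 x] fun _ ↦ 1 := by
  obtain ⟨C₁, hC₁0, hC₁⟩ := exists_abs_deriv_smoothTransition_le
  let χ : ContDiffBump (0 : EuclideanSpace ℝ (Fin d)) := ⟨1, 2, zero_lt_one, one_lt_two⟩
  have hχd : ContDiff ℝ ∞ χ := χ.contDiff
  obtain ⟨C₂, hC₂⟩ := (hχd.continuous_fderiv (by simp)).bounded_above_of_compact_support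
    (χ.hasCompactSupport.fderiv (𝕜 := ℝ))
  have hC₂0 : 0 ≤ C₂ := (norm_nonneg _).trans (hC₂ 0)
  let k : ℕ → ℝ := fun n ↦ n + 1
  have hk : ∀ n, 1 ≤ k n := fun n ↦ by simp [k]
  have hk0 : ∀ n, 0 < k n := fun n ↦ zero_lt_one.trans_le (hk n)
  let P : EuclideanSpace ℝ (Fin d) →L[ℝ] ℝ := EuclideanSpace.proj ⊤
  -- `f n` cuts off at infinity on the scale `k n`. `r n` cuts off at the boundary: it is `0` for
  -- `x_d ≤ 1 / k n` and `1` for `x_d ≥ 2 / k n`.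
  let f : ℕ → EuclideanSpace ℝ (Fin d) → ℝ := fun n x ↦ χ ((k n)⁻¹ • x)
  let r : ℕ → EuclideanSpace ℝ (Fin d) → ℝ := fun n x ↦ Real.smoothTransition (k n * x ⊤ - 1)
  have hf : ∀ n, ContDiff ℝ ∞ (f n) := fun n ↦ hχd.comp (contDiff_const_smul _)
  have hr : ∀ n, ContDiff ℝ ∞ (r n) := fun n ↦
    Real.smoothTransition.contDiff.comp
      ((contDiff_const.mul (P.contDiff)).sub contDiff_const)
  have hf' : ∀ n x, HasFDerivAt (f n) ((fderiv ℝ χ ((k n)⁻¹ • x)).comp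
      ((k n)⁻¹ • ContinuousLinearMap.id ℝ _)) x := fun n x ↦
    ((hχd.differentiable (by simp)) _).hasFDerivAt.comp x ((k n)⁻¹ • ContinuousLinearMap.id ℝ (EuclideanSpace ℝ (Fin d))).hasFDerivAt
  have hr' : ∀ n x, HasFDerivAt (r n)
      (deriv Real.smoothTransition (k n * x ⊤ - 1) • (k n • P)) x := fun n x ↦ by
    have h1 : HasDerivAt Real.smoothTransition
        (deriv Real.smoothTransition (k n * x ⊤ - 1)) (k n * x ⊤ - 1) :=
      ((Real.smoothTransition.contDiff (n := 1)).differentiable (by simp) _).hasDerivAt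
    exact h1.comp_hasFDerivAt x ((P.hasFDerivAt.const_mul (k n)).sub_const 1)
  have hf1 : ∀ n x, |f n x| ≤ 1 := fun n x ↦ by
    rw [abs_of_nonneg χ.nonneg]; exact χ.le_one
  have hr1 : ∀ n x, |r n x| ≤ 1 := fun n x ↦ by
    rw [abs_of_nonneg (Real.smoothTransition.nonneg _)]; exact Real.smoothTransition.le_one _
  refine ⟨fun n x ↦ f n x * r n x, C₂ + 2 * C₁, fun n ↦ ⟨(hf n).mul (hr n), ?_, ?_⟩, fun n x ↦ ?_,
    fun n x hx i ↦ ?_, fun x hx ↦ ?_⟩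
  · refine HasCompactSupport.mul_right ?_
    exact χ.hasCompactSupport.comp_smul (inv_ne_zero (hk0 n).ne')
  · have hsub : tsupport (fun x ↦ f n x * r n x) ⊆ {x | (k n)⁻¹ ≤ x ⊤} := by
      refine closure_minimal ?_ (isClosed_le continuous_const (by fun_prop))
      intro x hx
      by_contra hlt
      rw [mem_ofPred_eq, not_le] at hlt
      refine hx (mul_eq_zero_of_right _ (Real.smoothTransition.zero_of_nonpos ?_))
      have := mul_lt_mul_of_pos_left hlt (hk0 n)
      rw [mul_inv_cancel₀ (hk0 n).ne'] at this
      linarith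
    exact fun x hx ↦ (inv_pos.2 (hk0 n)).trans_le (hsub hx)
  · rw [abs_mul]
    exact mul_le_one₀ (hf1 n x) (abs_nonneg _) (hr1 n x)
  · have hx0 : 0 < x ⊤ := hx
    have hd := ((hf' n x).mul (hr' n x)).fderiv
    rw [partialDeriv]
    change |fderiv ℝ (f n * r n) x _| ≤ _
    rw [hd]
    simp only [_root_.add_apply, _root_.smul_apply, smul_eq_mul, ContinuousLinearMap.comp_apply,
      ContinuousLinearMap.id_apply]
    set e : EuclideanSpace ℝ (Fin d) := EuclideanSpace.single i 1
    have he : ‖e‖ = 1 := by simp [e]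
    have hPe : |P e| ≤ 1 := by
      have : |e ⊤| ≤ ‖e‖ := by simpa using PiLp.norm_apply_le e ⊤
      rwa [he] at this
    -- The factor `k n` is harmless: the derivative vanishes once `k n * x_d ≥ 2`, and otherwise `k
    -- n ≤ 2 / x_d`.
    have h1 : |deriv Real.smoothTransition (k n * x ⊤ - 1) * (k n * P e)| ≤ 2 * C₁ / x ⊤ := by
      rcases le_total (k n * x ⊤) 2 with h2 | h2
      · rw [abs_mul, abs_mul, abs_of_pos (hk0 n)]
        have : k n * |P e| ≤ 2 / x ⊤ := by
          rw [le_div_iff₀ hx0]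
          nlinarith [hk0 n, mul_pos (hk0 n) hx0, abs_nonneg (P e)]
        calc _ ≤ C₁ * (2 / x ⊤) :=
              mul_le_mul (hC₁ _) this (mul_nonneg (hk0 n).le (abs_nonneg _)) hC₁0
          _ = _ := by ring
      · have : deriv Real.smoothTransition (k n * x ⊤ - 1) = 0 := by
          have hmax : IsLocalMax Real.smoothTransition (k n * x ⊤ - 1) := by
            refine Eventually.of_forall fun s ↦ ?_
            rw [Real.smoothTransition.one_of_one_le (by linarith : 1 ≤ k n * x ⊤ - 1)]
            exact Real.smoothTransition.le_one _
          exact hmax.deriv_eq_zero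
        rw [this, zero_mul, abs_zero]
        positivity
    have h2 : |fderiv ℝ χ ((k n)⁻¹ • x) ((k n)⁻¹ • e)| ≤ C₂ := by
      refine ((fderiv ℝ χ ((k n)⁻¹ • x)).le_opNorm _).trans ?_
      rw [norm_smul, he, mul_one, norm_inv, Real.norm_of_nonneg (hk0 n).le]
      calc _ ≤ C₂ * 1 := mul_le_mul (hC₂ _) (inv_le_one_of_one_le₀ (hk n))
            (inv_nonneg.2 (hk0 n).le) hC₂0
        _ = C₂ := mul_one _
    refine (abs_add_le _ _).trans ?_
    rw [abs_mul (f n x), abs_mul (r n x)]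
    have h3 := mul_le_mul (hf1 n x) h1 (abs_nonneg _) zero_le_one
    have h4 := mul_le_mul (hr1 n x) h2 (abs_nonneg _) zero_le_one
    have h5 : 2 * C₁ / x ⊤ ≤ (C₂ + 2 * C₁) / x ⊤ := by gcongr; linarith
    linarith
  · have hx0 : 0 < x ⊤ := hx
    have hk_top : Tendsto k atTop atTop :=
      tendsto_atTop_add_const_right _ _ tendsto_natCast_atTop_atTop
    filter_upwards [hk_top.eventually_gt_atTop ‖x‖, hk_top.eventually_gt_atTop (2 / x ⊤)]
      with n hn1 hn2
    have o1 : ∀ᶠ y in 𝓝 x, ‖y‖ < k n := continuous_norm.continuousAt.eventually_lt_const hn1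
    have o2 : ∀ᶠ y in 𝓝 x, 2 / k n < P y := by
      refine P.continuous.continuousAt.eventually_const_lt ?_
      rw [div_lt_iff₀ hx0] at hn2
      rw [div_lt_iff₀ (hk0 n)]
      change 2 < x ⊤ * k n
      linarith
    filter_upwards [o1, o2] with y hy1 hy2
    have e1 : f n y = 1 := by
      refine χ.one_of_mem_closedBall ?_
      rw [mem_closedBall_zero_iff, norm_smul, norm_inv, Real.norm_of_nonneg (hk0 n).le,
        inv_mul_le_iff₀ (hk0 n)]
      change ‖y‖ ≤ k n * 1
      linarith
    have e2 : r n y = 1 := by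
      refine Real.smoothTransition.one_of_one_le ?_
      rw [div_lt_iff₀ (hk0 n)] at hy2
      have : 2 < y ⊤ * k n := hy2
      linarith
    rw [e1, e2, one_mul]

end Cutoff

/-! ### Admissibility of the separated test functions -/

section TestFunction

open scoped SchwartzMap LineDeriv

variable {d : ℕ}

theorem SchwartzMap.lineDeriv_single_eq_partialDeriv (b : 𝓢(EuclideanSpace ℝ (Fin d), ℝ))
    (i : Fin d) (x : EuclideanSpace ℝ (Fin d)) :
    (∂_{EuclideanSpace.single i (1 : ℝ)} b : 𝓢(EuclideanSpace ℝ (Fin d), ℝ)) x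
      = partialDeriv i b x :=
  SchwartzMap.lineDerivOp_apply_eq_fderiv _ _ _

theorem SchwartzMap.memW11 (Ω : Set (EuclideanSpace ℝ (Fin d)))
    (b : 𝓢(EuclideanSpace ℝ (Fin d), ℝ)) :
    MemW11 Ω b (fun i ↦
      (∂_{EuclideanSpace.single i (1 : ℝ)} b : 𝓢(EuclideanSpace ℝ (Fin d), ℝ))) := by
  refine ⟨b.integrable.integrableOn, fun i ↦ ⟨SchwartzMap.integrable _ |>.integrableOn,
    b.integrable.integrableOn.locallyIntegrableOn,
    (SchwartzMap.integrable _).integrableOn.locallyIntegrableOn, fun η ⟨hη, hηc, hηs⟩ ↦ ?_⟩⟩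
  have hz : ∀ x, x ∉ Ω → η x = 0 := fun x hx ↦ image_eq_zero_of_notMem_tsupport fun h ↦ hx (hηs h)
  have hz' : ∀ x, x ∉ Ω → partialDeriv i η x = 0 := fun x hx ↦ by
    rw [partialDeriv, image_eq_zero_of_notMem_tsupport (f := fderiv ℝ η)
      fun h ↦ hx (hηs (tsupport_fderiv_subset ℝ h))]
    rfl
  -- Since `η` is supported in `Ω`, both integrals extend to the whole space, where Schwartz
  -- integration by parts applies.
  rw [setIntegral_eq_integral_of_forall_compl_eq_zero (fun x hx ↦ by rw [hz' x hx, mul_zero]),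
    setIntegral_eq_integral_of_forall_compl_eq_zero (fun x hx ↦ by rw [hz x hx, mul_zero])]
  have := SchwartzMap.integral_mul_lineDerivOp_right_eq_neg_left (μ := volume) b
    (hηc.toSchwartzMap hη) (EuclideanSpace.single i 1)
  simp only [SchwartzMap.lineDeriv_single_eq_partialDeriv] at this ⊢
  exact this

theorem continuousInL1_mul {T : ℝ} {Ω : Set (EuclideanSpace ℝ (Fin d))} {a : ℝ → ℝ}
    (ha : Continuous a) {f : EuclideanSpace ℝ (Fin d) → ℝ} (hf : Integrable f) :
    ContinuousInL1 T Ω (fun t x ↦ a t * f x) := by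
  refine fun t _ ↦ ⟨(hf.const_mul _).integrableOn, ?_⟩
  simp_rw [← sub_mul, abs_mul, integral_const_mul]
  have : Tendsto (fun s ↦ |a s - a t| * ∫ x in Ω, |f x|) (𝓝 t)
      (𝓝 (|a t - a t| * ∫ x in Ω, |f x|)) := by
    refine Continuous.tendsto (by fun_prop) t
  rw [sub_self, abs_zero, zero_mul] at this
  exact this.mono_left nhdsWithin_le_nhds

theorem hasContinuousDerivInL1_mul {T : ℝ} {Ω : Set (EuclideanSpace ℝ (Fin d))} {a a' : ℝ → ℝ}
    (ha' : Continuous a') (ha : ∀ t, HasDerivAt a (a' t) t)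
    {f : EuclideanSpace ℝ (Fin d) → ℝ} (hf : Integrable f) :
    HasContinuousDerivInL1 T Ω (fun t x ↦ a t * f x) (fun t x ↦ a' t * f x) := by
  have hac : Continuous a := continuous_iff_continuousAt.2 fun t ↦ (ha t).continuousAt
  refine ⟨continuousInL1_mul hac hf, continuousInL1_mul ha' hf, fun t _ ↦ ?_⟩
  simp_rw [← sub_mul, ← mul_assoc, ← sub_mul, abs_mul, integral_const_mul]
  have h1 := (ha t).tendsto_slope
  have h2 : Tendsto (fun s ↦ |(s - t)⁻¹ * (a s - a t) - a' t| * ∫ x in Ω, |f x|) (𝓝[≠] t)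
      (𝓝 (|a' t - a' t| * ∫ x in Ω, |f x|)) := (h1.sub_const (a' t)).abs.mul_const _
  rw [sub_self, abs_zero, zero_mul] at h2
  exact h2.mono_left (nhdsWithin_mono _ fun s hs ↦ hs.2)

variable [NeZero d]

/-- The approximants are `m n * b`, with dominated convergence. The dangerous term `b ∂_i (m n)` has
an integrable majorant because `|b| ≤ x_d M` cancels the `1 / x_d` growth of the cutoff gradient. -/
theorem SchwartzMap.memW11Zero_halfSpace (b : 𝓢(EuclideanSpace ℝ (Fin d), ℝ))
    (hb : ∀ x, x (⊤ : Fin d) = 0 → b x = 0) : MemW11Zero (halfSpace d) b := by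
  refine ⟨_, b.memW11 _, fun ε hε ↦ ?_⟩
  obtain ⟨m, C, hm, hm1, hmd, hme⟩ := exists_halfSpace_cutoff d
  obtain ⟨M, hM, hbM⟩ := b.exists_integrable_abs_le_mul hb
  let D : Fin d → 𝓢(EuclideanSpace ℝ (Fin d), ℝ) := fun i ↦ ∂_{EuclideanSpace.single i (1 : ℝ)} b
  have hD : ∀ i x, D i x = partialDeriv i b x := fun i x ↦ b.lineDeriv_single_eq_partialDeriv i x
  let η : ℕ → EuclideanSpace ℝ (Fin d) → ℝ := fun n x ↦ m n x * b x
  have hη : ∀ n, IsSmoothCompactlySupportedIn (halfSpace d) (η n) := fun n ↦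
    ⟨(hm n).1.mul (b.smooth ⊤), (hm n).2.1.mul_right, (tsupport_mul_subset_left).trans (hm n).2.2⟩
  have hηd : ∀ n x i, partialDeriv i (η n) x = m n x * D i x + b x * partialDeriv i (m n) x := by
    intro n x i
    have := (((hm n).1.differentiable (by simp) x).hasFDerivAt.mul (b.hasFDerivAt x)).fderiv
    rw [hD, partialDeriv]
    change fderiv ℝ (m n * ⇑b) x _ = _
    rw [this]
    rfl
  let F : ℕ → EuclideanSpace ℝ (Fin d) → ℝ := fun n x ↦
    |b x - η n x| + ∑ i, |D i x - partialDeriv i (η n) x|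
  let G : EuclideanSpace ℝ (Fin d) → ℝ := fun x ↦
    2 * |b x| + ∑ i : Fin d, (2 * |D i x| + (|C| * |b x| + |C| * M x))
  have hG : Integrable G :=
    (b.integrable.abs.const_mul 2).add (integrable_finsetSum _ fun i _ ↦
      ((D i).integrable.abs.const_mul 2).add
        ((b.integrable.abs.const_mul _).add (hM.const_mul _)))
  have hΩ := (isOpen_halfSpace d).measurableSet
  have hcont : ∀ n i, Continuous fun x ↦ partialDeriv i (η n) x := fun n i ↦
    ((hη n).1.continuous_fderiv (by simp)).clm_apply continuous_const
  have hlim : Tendsto (fun n ↦ ∫ x in halfSpace d, F n x) atTop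
      (𝓝 (∫ x in halfSpace d, (0 : ℝ))) := by
    refine tendsto_integral_of_dominated_convergence G (fun n ↦ ?_) hG.integrableOn
      (fun n ↦ ?_) ?_
    · refine Continuous.aestronglyMeasurable ?_
      refine (b.continuous.sub (hη n).1.continuous).abs.add
        (continuous_finsetSum _ fun i _ ↦ ((D i).continuous.sub (hcont n i)).abs)
    · refine (ae_restrict_iff' hΩ).2 (Eventually.of_forall fun x hx ↦ ?_)
      have hx0 : 0 < x ⊤ := hx
      have hF0 : 0 ≤ F n x := by positivity
      rw [Real.norm_of_nonneg hF0]
      have key : ∀ a : ℝ, |m n x * a| ≤ |a| := fun a ↦ by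
        rw [abs_mul]; exact mul_le_of_le_one_left (abs_nonneg _) (hm1 n x)
      refine add_le_add ?_ (Finset.sum_le_sum fun i _ ↦ ?_)
      · have := abs_sub (b x) (η n x)
        linarith [key (b x)]
      · rw [hηd]
        have h1 := abs_sub (D i x) (m n x * D i x + b x * partialDeriv i (m n) x)
        have h2 := abs_add_le (m n x * D i x) (b x * partialDeriv i (m n) x)
        have h3 : |b x * partialDeriv i (m n) x| ≤ |C| * |b x| + |C| * M x := by
          rw [abs_mul]
          have h4 : |partialDeriv i (m n) x| ≤ |C| + |C| / x ⊤ := by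
            refine (hmd n x hx i).trans ?_
            gcongr <;> exact le_abs_self C
          have h5 : |b x| * (|C| / x ⊤) ≤ |C| * M x := by
            rw [← mul_div_assoc, div_le_iff₀ hx0]
            nlinarith [hbM x hx, abs_nonneg C]
          calc _ ≤ |b x| * (|C| + |C| / x ⊤) := by gcongr
            _ ≤ _ := by linarith
        linarith [key (D i x)]
    · refine (ae_restrict_iff' hΩ).2 (Eventually.of_forall fun x hx ↦ ?_)
      refine tendsto_const_nhds.congr' ?_
      filter_upwards [hme x hx] with n hn
      have h1 : m n x = 1 := hn.self_of_nhds
      have h2 : ∀ i, partialDeriv i (m n) x = 0 := fun i ↦ by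
        rw [partialDeriv, hn.fderiv_eq, fderiv_fun_const]; rfl
      simp [F, hηd, h1, h2, η]
  rw [integral_zero] at hlim
  obtain ⟨n, hn⟩ := (hlim.eventually_lt_const hε).exists
  exact ⟨η n, hη n, hn⟩

theorem isHeatTestFunction_exp_mul {T : ℝ} {l : ℝ} (hl : 0 ≤ l)
    (b : 𝓢(EuclideanSpace ℝ (Fin d), ℝ)) (hb : ∀ x, x (⊤ : Fin d) = 0 → b x = 0) :
    IsHeatTestFunction T (halfSpace d) (fun t x ↦ Real.exp (-l * t) * b x)
      (fun t x ↦ (Real.exp (-l * t) * -l) * b x)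
      (fun i t x ↦ Real.exp (-l * t) *
        (∂_{EuclideanSpace.single i (1 : ℝ)} b : 𝓢(EuclideanSpace ℝ (Fin d), ℝ)) x)
      (fun i j t x ↦ Real.exp (-l * t) * (∂_{EuclideanSpace.single j (1 : ℝ)}
        (∂_{EuclideanSpace.single i (1 : ℝ)} b) : 𝓢(EuclideanSpace ℝ (Fin d), ℝ)) x) := by
  have hmeas : ∀ (a : ℝ → ℝ) (_ : Continuous a) (f : 𝓢(EuclideanSpace ℝ (Fin d), ℝ)),
      AEStronglyMeasurable (Function.uncurry fun t x ↦ a t * f x)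
        (volume.restrict (Ioo 0 T ×ˢ halfSpace d)) := fun a ha f ↦
    Continuous.aestronglyMeasurable
      ((ha.comp continuous_fst).mul (f.continuous.comp continuous_snd))
  have hexp : Continuous fun t ↦ Real.exp (-l * t) := by fun_prop
  have hexp' : Continuous fun t ↦ Real.exp (-l * t) * -l := by fun_prop
  refine ⟨hmeas _ hexp' b, fun i ↦ hmeas _ hexp _, fun i j ↦ hmeas _ hexp _, fun t _ ↦ ?_,
    fun t _ ↦ ?_, fun t _ ↦ ?_, continuousInL1_mul hexp b.integrable,
    fun i ↦ continuousInL1_mul hexp (SchwartzMap.integrable _),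
    fun i j ↦ continuousInL1_mul hexp (SchwartzMap.integrable _), fun t _ ↦ ?_,
    hasContinuousDerivInL1_mul hexp' (fun t ↦ ?_) b.integrable, ?_⟩
  · exact (Real.exp (-l * t) • b).memW11Zero_halfSpace fun x hx ↦ by simp [hb x hx]
  · refine ⟨?_, fun i ↦ ?_⟩
    · have := (Real.exp (-l * t) • b).memW11 (halfSpace d)
      simp_rw [LineDeriv.lineDerivOp_smul] at this
      exact this
    · have := (Real.exp (-l * t) •
        (∂_{EuclideanSpace.single i (1 : ℝ)} b : 𝓢(EuclideanSpace ℝ (Fin d), ℝ))).memW11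
          (halfSpace d)
      simp_rw [LineDeriv.lineDerivOp_smul] at this
      exact this
  · exact (continuous_const.mul b.continuous).continuousOn
  · refine TendstoUniformlyOn.tendstoLocallyUniformlyOn ?_
    rw [Metric.tendstoUniformlyOn_iff]
    intro ε hε
    set K := SchwartzMap.seminorm ℝ 0 0 b
    have hK : 0 ≤ K := apply_nonneg _ _
    have hlim : Tendsto (fun s ↦ |Real.exp (-l * t) - Real.exp (-l * s)| * K) (𝓝 t)
        (𝓝 (|Real.exp (-l * t) - Real.exp (-l * t)| * K)) :=
      Continuous.tendsto (by fun_prop) t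
    rw [sub_self, abs_zero, zero_mul] at hlim
    filter_upwards [nhdsWithin_le_nhds (hlim.eventually_lt_const hε)] with s hs x _
    rw [Real.dist_eq, ← sub_mul, abs_mul]
    refine lt_of_le_of_lt ?_ hs
    gcongr
    exact b.norm_le_seminorm ℝ x
  · simpa using ((hasDerivAt_id t).const_mul (-l)).exp
  · obtain ⟨C, hC0, hC⟩ := b.exists_norm_le_one_add_norm_pow d
    -- Each of the `d` components obeys the bound with constant `C`, and the Euclidean norm is at
    -- most the sum of their absolute values.
    refine ⟨d * C, fun t ht ↦ Eventually.of_forall fun x ↦ ?_⟩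
    have he : Real.exp (-l * t) ≤ 1 := Real.exp_le_one_iff.2 (by nlinarith [ht.1])
    have hnorm : (1 + ‖x‖ ^ 2) ^ ((d : ℝ) / 2) ≤ (1 + ‖x‖) ^ d := by
      have : (1 + ‖x‖) ^ d = ((1 + ‖x‖) ^ 2) ^ ((d : ℝ) / 2) := by
        rw [← Real.rpow_natCast, ← Real.rpow_natCast, ← Real.rpow_mul (by positivity)]
        congr 1
        push_cast
        ring
      rw [this]
      gcongr
      nlinarith [norm_nonneg x]
    have hterm : ∀ i : Fin d, |Real.exp (-l * t) *
        (∂_{EuclideanSpace.single i (1 : ℝ)} b : 𝓢(EuclideanSpace ℝ (Fin d), ℝ)) x|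
          ≤ C * (1 + ‖x‖ ^ 2) ^ (-(d : ℝ) / 2) := by
      intro i
      rw [abs_mul, abs_of_pos (Real.exp_pos _), b.lineDeriv_single_eq_partialDeriv]
      refine (mul_le_of_le_one_left (abs_nonneg _) he).trans ?_
      have := (fderiv ℝ b x).le_opNorm (EuclideanSpace.single i 1)
      simp only [PiLp.norm_single, norm_one, mul_one] at this
      refine (this.trans (hC x)).trans ?_
      rw [neg_div, Real.rpow_neg (by positivity)]
      gcongr
    refine (Real.sqrt_le_left (by positivity)).2 ?_
    calc _ ≤ (∑ i : Fin d, |Real.exp (-l * t) *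
        (∂_{EuclideanSpace.single i (1 : ℝ)} b : 𝓢(EuclideanSpace ℝ (Fin d), ℝ)) x|) ^ 2 := by
          simp_rw [← sq_abs (Real.exp (-l * t) * _)]
          exact Finset.sum_sq_le_sq_sum_of_nonneg fun i _ ↦ abs_nonneg _
      _ ≤ _ := by
          gcongr
          refine (Finset.sum_le_sum fun i _ ↦ hterm i).trans ?_
          simp [mul_assoc]

/-- The functions `exp (-(2π)² (n + 1) t) ζ x` are in the range of the backward heat operator on
test functions. -/
theorem exists_isHeatTestFunction_heat_eq {T : ℝ} {ζ : EuclideanSpace ℝ (Fin d) → ℝ}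
    (hζ : IsSmoothCompactlySupportedIn (halfSpace d) ζ) (n : ℕ) :
    ∃ (φ φt : ℝ → EuclideanSpace ℝ (Fin d) → ℝ) (g : Fin d → ℝ → EuclideanSpace ℝ (Fin d) → ℝ)
      (h : Fin d → Fin d → ℝ → EuclideanSpace ℝ (Fin d) → ℝ),
      IsHeatTestFunction T (halfSpace d) φ φt g h ∧ ∀ t, ∀ x ∈ halfSpace d,
        φt t x + ∑ i, h i i t x = Real.exp (-(2 * Real.pi) ^ 2 * t) ^ (n + 1) * ζ x := by
  obtain ⟨hζ, hζc, hζs⟩ := hζ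
  obtain ⟨b, hb0, hb⟩ := exists_schwartz_dirichlet_resolvent (d := d)
    (show (0 : ℝ) < (n + 1 : ℕ) by positivity) (hζc.toSchwartzMap hζ) fun x hx ↦
      image_eq_zero_of_notMem_tsupport fun h ↦ absurd (hζs h) (not_lt.2 hx)
  -- The rate `l` equals the resolvent parameter with `c = n + 1`, so `∂_t φ + Δ φ = exp (-l t) (Δ b
  -- - l b)`. The shift from `n` keeps `c` positive.
  refine ⟨_, _, _, _, isHeatTestFunction_exp_mul (T := T)
    (l := (2 * Real.pi) ^ 2 * (n + 1 : ℕ)) (by positivity) b hb0, fun t x hx ↦ ?_⟩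
  have h1 : _ = ζ x := hb x hx
  rw [← h1, ← Real.exp_nat_mul, show ((n + 1 : ℕ) : ℝ) * (-(2 * Real.pi) ^ 2 * t)
    = -((2 * Real.pi) ^ 2 * (n + 1 : ℕ)) * t by ring, ← Finset.mul_sum]
  ring

end TestFunction

/-! ### Uniqueness from exponential moments -/

section Uniqueness

/-- An integrable function on a bounded interval is determined by its exponential moments. -/
theorem ae_eq_zero_of_forall_integral_mul_exp_pow {T a : ℝ} (ha : 0 < a) {v : ℝ → ℝ}
    (hv : IntegrableOn v (Ioo 0 T))
    (h : ∀ n : ℕ, ∫ t in Ioo 0 T, v t * Real.exp (-a * t) ^ n = 0) :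
    v =ᵐ[volume.restrict (Ioo 0 T)] 0 := by
  have hexp : Continuous fun t ↦ Real.exp (-a * t) := by fun_prop
  have hbdd : ∀ (ψ : ℝ → ℝ), Continuous ψ →
      IntegrableOn (fun t ↦ v t * ψ t) (Ioo 0 T) := fun ψ hψ ↦ by
    obtain ⟨C, hC⟩ := (isCompact_Icc (a := (0 : ℝ)) (b := T)).exists_bound_of_continuousOn
      hψ.continuousOn
    refine hv.mul_bdd (c := C) hψ.aestronglyMeasurable ?_
    exact (ae_restrict_iff' measurableSet_Ioo).2
      (Eventually.of_forall fun t ht ↦ hC t (Ioo_subset_Icc_self ht))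
  have hpoly : ∀ p : Polynomial ℝ, ∫ t in Ioo 0 T, v t * p.eval (Real.exp (-a * t)) = 0 := by
    intro p
    simp_rw [Polynomial.eval_eq_sum_range, Finset.mul_sum]
    rw [integral_finsetSum]
    · refine Finset.sum_eq_zero fun n _ ↦ ?_
      simp_rw [mul_left_comm (v _)]
      rw [integral_const_mul, h, mul_zero]
    · exact fun n _ ↦ hbdd _ (continuous_const.mul (hexp.pow n))
  have hcont : ∀ ψ : ℝ → ℝ, Continuous ψ → ∫ t in Ioo 0 T, v t * ψ t = 0 := by
    intro ψ hψ
    set A := ∫ t in Ioo 0 T, |v t|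
    have hA : 0 ≤ A := integral_nonneg fun _ ↦ abs_nonneg _
    rw [← abs_nonpos_iff]
    refine le_of_forall_pos_le_add fun ε hε ↦ ?_
    rw [zero_add]
    -- Weierstrass in the variable `y = exp (-a t)`, which maps `[0, T]` onto `[exp (-a T), 1]`. The
    -- tolerance uses `A + 1` because `A` may be zero.
    obtain ⟨p, hp⟩ := exists_polynomial_near_of_continuousOn (Real.exp (-a * T)) 1
      (fun y ↦ ψ (-Real.log y / a)) (by
        refine hψ.comp_continuousOn ((ContinuousOn.neg ?_).div_const a)
        exact Real.continuousOn_log.mono fun y hy ↦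
          ((Real.exp_pos _).trans_le hy.1).ne') (ε / (A + 1)) (by positivity)
    have hsub : ∫ t in Ioo 0 T, v t * ψ t
        = ∫ t in Ioo 0 T, v t * (ψ t - p.eval (Real.exp (-a * t))) := by
      simp_rw [mul_sub]
      have hp' : IntegrableOn (fun t ↦ v t * p.eval (Real.exp (-a * t))) (Ioo 0 T) :=
        hbdd _ (p.continuous.comp hexp)
      rw [integral_sub (hbdd _ hψ) hp', hpoly, sub_zero]
    rw [hsub]
    calc _ ≤ ∫ t in Ioo 0 T, |v t| * (ε / (A + 1)) := by
          rw [← Real.norm_eq_abs]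
          refine norm_integral_le_of_norm_le (hv.abs.mul_const _) ?_
          refine (ae_restrict_iff' measurableSet_Ioo).2 (Eventually.of_forall fun t ht ↦ ?_)
          rw [norm_mul, Real.norm_eq_abs, Real.norm_eq_abs]
          gcongr
          have h1 : Real.exp (-a * t) ∈ Icc (Real.exp (-a * T)) 1 :=
            ⟨Real.exp_le_exp.2 (by nlinarith [ht.2]), Real.exp_le_one_iff.2 (by nlinarith [ht.1])⟩
          have h2 := hp _ h1
          rw [Real.log_exp, neg_mul, neg_neg, mul_div_cancel_left₀ _ ha.ne', abs_sub_comm] at h2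
          simpa using h2.le
      _ = A * (ε / (A + 1)) := integral_mul_const _ _
      _ ≤ ε := by
          rw [mul_div_assoc', div_le_iff₀ (by positivity)]
          nlinarith
  have := isOpen_Ioo.ae_eq_zero_of_integral_contDiff_smul_eq_zero (μ := volume)
    hv.locallyIntegrableOn (fun g hg hgc hgs ↦ ?_)
  · exact (ae_restrict_iff' measurableSet_Ioo).2 this
  · rw [← setIntegral_eq_integral_of_forall_compl_eq_zero (s := Ioo 0 T)]
    · simpa only [smul_eq_mul, mul_comm] using hcont g hg.continuous
    · intro x hx
      rw [image_eq_zero_of_notMem_tsupport fun h ↦ hx (hgs h), zero_smul]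

/-- An integrable function on a cylinder is determined by its integrals against
`exp (-a n t) ζ x`. -/
theorem ae_eq_zero_of_forall_integral_mul_exp_pow_mul {d : ℕ} {T a : ℝ} (ha : 0 < a)
    {Ω : Set (EuclideanSpace ℝ (Fin d))} (hΩ : IsOpen Ω) {w : ℝ × EuclideanSpace ℝ (Fin d) → ℝ}
    (hw : IntegrableOn w (Ioo 0 T ×ˢ Ω))
    (h : ∀ ζ, IsSmoothCompactlySupportedIn Ω ζ → ∀ n : ℕ,
      ∫ z in Ioo 0 T ×ˢ Ω, w z * (Real.exp (-a * z.1) ^ n * ζ z.2) = 0) :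
    w =ᵐ[volume.restrict (Ioo 0 T ×ˢ Ω)] 0 := by
  have hvol : (volume.restrict (Ioo 0 T ×ˢ Ω) : Measure (ℝ × EuclideanSpace ℝ (Fin d)))
      = (volume.restrict (Ioo 0 T)).prod (volume.restrict Ω) := by
    rw [Measure.prod_restrict]; rfl
  rw [IntegrableOn, hvol] at hw
  rw [hvol] at h ⊢
  have hwn : ∀ n : ℕ, Integrable (fun z ↦ w z * Real.exp (-a * z.1) ^ n)
      ((volume.restrict (Ioo 0 T)).prod (volume.restrict Ω)) := fun n ↦ by
    refine hw.mul_bdd (c := 1) (Continuous.aestronglyMeasurable (by fun_prop)) ?_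
    rw [← hvol]
    refine (ae_restrict_iff' (measurableSet_Ioo.prod hΩ.measurableSet)).2
      (Eventually.of_forall fun z hz ↦ ?_)
    rw [norm_pow, Real.norm_of_nonneg (Real.exp_pos _).le]
    exact pow_le_one₀ (Real.exp_pos _).le (Real.exp_le_one_iff.2 (by nlinarith [hz.1.1]))
  -- By Fubini, the `n`-th moment in time is a function of `x` orthogonal to all of `C_c^∞(Ω)`.
  have hmom : ∀ n : ℕ, ∀ᵐ x ∂(volume.restrict Ω),
      ∫ t in Ioo 0 T, w (t, x) * Real.exp (-a * t) ^ n = 0 := by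
    intro n
    refine (ae_restrict_iff' hΩ.measurableSet).2
      (hΩ.ae_eq_zero_of_integral_contDiff_smul_eq_zero
        (IntegrableOn.locallyIntegrableOn (hwn n).integral_prod_right) fun ζ hζ hζc hζs ↦ ?_)
    obtain ⟨C, hC⟩ := hζ.continuous.bounded_above_of_compact_support hζc
    have hint : Integrable (fun z ↦ w z * Real.exp (-a * z.1) ^ n * ζ z.2)
        ((volume.restrict (Ioo 0 T)).prod (volume.restrict Ω)) :=
      (hwn n).mul_bdd (c := C)
        (hζ.continuous.comp continuous_snd).aestronglyMeasurable
        (Eventually.of_forall fun z ↦ hC z.2)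
    rw [← setIntegral_eq_integral_of_forall_compl_eq_zero (s := Ω)]
    · have := h ζ ⟨hζ, hζc, hζs⟩ n
      simp_rw [← mul_assoc] at this
      rw [integral_prod_symm _ hint] at this
      refine Eq.trans (integral_congr_ae ?_) this
      refine Eventually.of_forall fun x ↦ ?_
      dsimp only
      rw [integral_mul_const, smul_eq_mul, mul_comm]
    · intro x hx
      rw [image_eq_zero_of_notMem_tsupport fun h ↦ hx (hζs h), zero_smul]
  have hzero : ∀ᵐ x ∂(volume.restrict Ω), ∫ t in Ioo 0 T, ‖w (t, x)‖ = 0 := by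
    -- There are countably many moments, so off a single null set of `x` they all vanish and the
    -- whole time slice is zero.
    filter_upwards [ae_all_iff.2 hmom, hw.prod_left_ae] with x hx hxi
    have := ae_eq_zero_of_forall_integral_mul_exp_pow ha hxi hx
    refine integral_eq_zero_of_ae ?_
    filter_upwards [this] with t ht
    simp [ht]
  have hnorm : ∫ z, ‖w z‖ ∂((volume.restrict (Ioo 0 T)).prod (volume.restrict Ω)) = 0 := by
    rw [integral_prod_symm _ hw.norm]
    exact integral_eq_zero_of_ae hzero
  have := (integral_eq_zero_iff_of_nonneg (fun _ ↦ norm_nonneg _) hw.norm).1 hnorm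
  filter_upwards [this] with z hz
  simpa using hz

end Uniqueness

/-! ### Conclusion by localisation -/

theorem mainTheorem3 (d : ℕ) [NeZero d] (T : ℝ) (hT : 0 < T)
    (u : ℝ × EuclideanSpace ℝ (Fin d) → ℝ)
    (hu : ∀ (φ φt : ℝ → EuclideanSpace ℝ (Fin d) → ℝ)
      (g : Fin d → ℝ → EuclideanSpace ℝ (Fin d) → ℝ)
      (h : Fin d → Fin d → ℝ → EuclideanSpace ℝ (Fin d) → ℝ),
      IsHeatTestFunction T (halfSpace d) φ φt g h →
        IntegrableOn (fun z => u z * (φt z.1 z.2 + ∑ i, h i i z.1 z.2))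
          (Ioo 0 T ×ˢ halfSpace d) ∧
        ∫ z in Ioo 0 T ×ˢ halfSpace d, u z * (φt z.1 z.2 + ∑ i, h i i z.1 z.2) = 0) :
    u =ᵐ[volume.restrict (Ioo 0 T ×ˢ halfSpace d)] 0 := by
  have hΩ := isOpen_halfSpace d
  have hS : MeasurableSet (Ioo 0 T ×ˢ halfSpace d) := measurableSet_Ioo.prod hΩ.measurableSet
  have ha : 0 < (2 * Real.pi) ^ 2 := by positivity
  have key : ∀ ζ, IsSmoothCompactlySupportedIn (halfSpace d) ζ → ∀ n : ℕ,
      IntegrableOn (fun z ↦ u z * (Real.exp (-(2 * Real.pi) ^ 2 * z.1) ^ (n + 1) * ζ z.2))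
        (Ioo 0 T ×ˢ halfSpace d) ∧
      ∫ z in Ioo 0 T ×ˢ halfSpace d,
        u z * (Real.exp (-(2 * Real.pi) ^ 2 * z.1) ^ (n + 1) * ζ z.2) = 0 := by
    intro ζ hζ n
    obtain ⟨φ, φt, g, h, hφ, hcongr⟩ := exists_isHeatTestFunction_heat_eq (T := T) hζ n
    have := hu φ φt g h hφ
    exact ⟨this.1.congr_fun (fun z hz ↦ congrArg (u z * ·) (hcongr z.1 z.2 hz.2)) hS,
      (setIntegral_congr_fun hS fun z hz ↦
        congrArg (u z * ·) (hcongr z.1 z.2 hz.2)).symm.trans this.2⟩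
  obtain ⟨m, C, hm, -, -, hme⟩ := exists_halfSpace_cutoff d
  -- No integrability or measurability of `u` is given. Testing with `ζ = m k` shows that `u` times
  -- one exponential and `m k` is integrable. This product is taken as `w`: its factor `exp ^ (0 +
  -- 1)` turns the `n`-th moment of `w` into the available exponent `n + 1`, tested with `m k * ζ`.
  have hz : ∀ k, ∀ᵐ z ∂(volume.restrict (Ioo 0 T ×ˢ halfSpace d)), u z * m k z.2 = 0 := by
    intro k
    have := ae_eq_zero_of_forall_integral_mul_exp_pow_mul ha hΩ
      (w := fun z ↦ u z * (Real.exp (-(2 * Real.pi) ^ 2 * z.1) ^ (0 + 1) * m k z.2))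
      (key _ (hm k) 0).1 fun ζ ⟨hζ, _, _⟩ n ↦ by
        have := (key (fun x ↦ m k x * ζ x) ⟨(hm k).1.mul hζ, (hm k).2.1.mul_right,
          tsupport_mul_subset_left.trans (hm k).2.2⟩ n).2
        refine Eq.trans (integral_congr_ae (Eventually.of_forall fun z ↦ ?_)) this
        ring
    filter_upwards [this] with z hz
    have h2 := (Real.exp_pos (-(2 * Real.pi) ^ 2 * z.1)).ne'
    simpa [h2] using hz
  -- Countably many cutoffs cost one null set, and at each point some cutoff equals `1`.
  filter_upwards [ae_all_iff.2 hz, ae_restrict_mem hS] with z h1 h2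
  obtain ⟨k, hk⟩ := (hme z.2 h2.2).exists
  simpa [hk.self_of_nhds] using h1 k
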